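/- Let $T$ be a (finitary, single-sorted) Lawvere theory: a small category with finite products in which every object is isomorphic to a finite power of a distinguished object $x$. A model of $T$ in a category $\mathcal D$ is a finite-product-preserving functor $T\to\mathcal D$, and its underlying object is its value at $x$. Let $\mathcal V$ be the variety of algebras of $T$, that is, the category of models of $T$ in $\mathbf{Set}$, with forgetful functor $|\cdot|\colon\mathcal V\to\mathbf{Set}$ and free functor $F\dashv|\cdot|$. Let $\mathcal V\mathcal V^{c}$ be the category of co-$\mathcal V$-algebra objects in $\mathcal V$, that is, the opposite of the category of models of $T$ in $\mathcal V^{\mathrm{op}}$. Each co-$\mathcal V$-algebra object $X$ in $\mathcal V$ represents a functor $\mathrm{Hom}(X,-)\colon\mathcal V\to\mathcal V$, and $X\mapsto\mathrm{Hom}(X,-)$ is a fully faithful functor $(\mathcal V\mathcal V^{c})^{\mathrm{op}}\to\mathrm{Fun}(\mathcal V,\mathcal V)$. The Tall--Wraith monoidal structure $(\odot,I)$ on $\mathcal V\mathcal V^{c}$ is the one corresponding under this functor to composition of functors, so that $\mathrm{Hom}(X\odot Y,-)\cong\mathrm{Hom}(X,\mathrm{Hom}(Y,-))$ and $\mathrm{Hom}(I,-)\cong\mathrm{id}_{\mathcal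 V}$. Then $F\colon\mathbf{Set}\to\mathcal V$ has a lift to a functor $\hat F\colon\mathbf{Set}\to\mathcal V\mathcal V^{c}$: the composite of $\hat F$ with the forgetful functor $\mathcal V\mathcal V^{c}\to\mathcal V$ is naturally isomorphic to $F$, and, for every set $S$ and every algebra $A$ in $\mathcal V$, the adjunction bijection $\mathrm{Hom}_{\mathcal V}(F(S),A)\cong\mathrm{Hom}_{\mathbf{Set}}(S,|A|)$ underlies an isomorphism of $\mathcal V$-algebras $\mathrm{Hom}(\hat F(S),A)\cong A^{S}$. Moreover $\hat F$ is strong monoidal from $(\mathbf{Set},\times,\{*\})$ to $(\mathcal V\mathcal V^{c},\odot,I)$. In particular $\hat F(S\times R)\cong\hat F(S)\odot\hat F(R)$ for all sets $S,R$, and $\hat F(\{*\})\cong I$. -/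

import Mathlib

open CategoryTheory CategoryTheory.Limits CategoryTheory.MonoidalCategory Opposite

universe u v v' w w'

namespace TallWraith

/-- A (finitary, single-sorted) Lawvere theory: a small category with finite products in which
every object is isomorphic to a finite power of a distinguished object `gen`. -/
class LawvereTheory (T : Type u) [SmallCategory T] where
  [hasFiniteProducts : HasFiniteProducts T]
  /-- The distinguished object. -/
  gen : T
  exists_iso_power (t : T) : ∃ n : ℕ, Nonempty (t ≅ ∏ᶜ fun _ : Fin n => gen)

attribute [instance] LawvereTheory.hasFiniteProducts

/-- The property of preserving finite products, for functors `T ⥤ D`. -/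
abbrev preservesProducts (T : Type u) [Category.{v} T] (D : Type w) [Category.{v'} D] :
    ObjectProperty (T ⥤ D) :=
  fun F => PreservesFiniteProducts F

/-- The category of models of `T` in `D` (the `T`-algebra objects in `D`): finite product
preserving functors `T ⥤ D` and natural transformations. -/
abbrev Model (T : Type u) [Category.{v} T] (D : Type w) [Category.{v'} D] :=
  (preservesProducts T D).FullSubcategory

/-- The variety of algebras defined by `T`: the category of models of `T` in sets. -/
abbrev Variety (T : Type u) [SmallCategory T] := Model T (Type u)

/-- The category of co-`T`-algebra objects in `D`: the opposite of the category of models of `T`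
in `Dᵒᵖ`. -/
abbrev CoModel (T : Type u) [Category.{v} T] (D : Type w) [Category.{v'} D] :=
  (Model T Dᵒᵖ)ᵒᵖ

/-- The underlying object `|X|` of a model: its value at the distinguished object. -/
abbrev underlying (T : Type u) [SmallCategory T] [LawvereTheory T]
    (D : Type w) [Category.{v'} D] : Model T D ⥤ D :=
  (preservesProducts T D).ι ⋙ (evaluation T D).obj LawvereTheory.gen

/-- The underlying object of a co-`T`-algebra object. -/
abbrev coUnderlying (T : Type u) [SmallCategory T] [LawvereTheory T]
    (D : Type w) [Category.{v'} D] : CoModel T D ⥤ D :=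
  (underlying T Dᵒᵖ).leftOp

section Reflective

theorem isRightAdjoint_aux (C : Type u) [SmallCategory C] :
    (preservesProducts Cᵒᵖ (Type u)).ι.IsRightAdjoint := by
  let W : MorphismProperty (Cᵒᵖ ⥤ Type u) :=
    ⨆ (n : ULift.{u} ℕ), ⨆ (F : Discrete (Fin n.down) ⥤ Cᵒᵖ),
      MorphismProperty.ofHoms (Presheaf.preservesLimitHomFamily.{u} F)
  have hW : preservesProducts Cᵒᵖ (Type u) = W.isLocal := by
    simp only [W, MorphismProperty.isLocal_iSup]
    simp only [← Presheaf.preservesLimit_eq_isLocal]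
    ext F
    simp only [iInf_apply, ObjectProperty.preservesLimit_iff, iInf_Prop_eq]
    constructor
    · intro h n G
      have := h.preserves n.down
      infer_instance
    · intro h
      exact ⟨fun n => ⟨fun {G} => h ⟨n⟩ G⟩⟩
  let κ : Cardinal.{u} := Cardinal.aleph0
  have : Fact κ.IsRegular := ⟨Cardinal.isRegular_aleph0⟩
  have hy : ∀ X : C, IsCardinalPresentable (shrinkYoneda.{u}.obj X) κ := by
    intro X
    have : IsCardinalPresentable (uliftYoneda.{u}.obj X) κ := inferInstance
    exact isCardinalPresentable_of_iso (uliftYonedaIsoShrinkYoneda.{u}.app X) κ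
  have hs (n : ℕ) : Small.{u} (Discrete (Fin n) ⥤ Cᵒᵖ) := by
    refine small_of_surjective (f := fun g : Fin n → Cᵒᵖ => Discrete.functor g) fun F => ?_
    exact ⟨fun i => F.obj ⟨i⟩, CategoryTheory.Functor.ext (fun _ => rfl) (by
      rintro ⟨i⟩ ⟨j⟩ ⟨⟨h⟩⟩
      obtain rfl : i = j := h
      simp)⟩
  rw [hW]
  refine MorphismProperty.isRightAdjoint_ι_isLocal W κ ?_
  intro X Y f hf
  simp only [W, MorphismProperty.iSup_iff] at hf
  obtain ⟨n, F, ⟨h⟩⟩ := hf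
  refine ⟨?_, hy _⟩
  have : ∀ j, IsCardinalPresentable ((F.leftOp ⋙ shrinkYoneda.{u}).obj j) κ := fun j => hy _
  refine isCardinalPresentable_of_isColimit _ (colimit.isColimit _) κ ?_
  exact hasCardinalLT_of_finite _ _ le_rfl

instance isRightAdjoint_ι (T : Type u) [SmallCategory T] :
    (preservesProducts T (Type u)).ι.IsRightAdjoint := by
  let P := preservesProducts T (Type u)
  let P' := preservesProducts Tᵒᵖᵒᵖ (Type u)
  have : P'.ι.IsRightAdjoint := isRightAdjoint_aux Tᵒᵖ
  let e := (opOpEquivalence T).congrLeft (E := Type u)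
  let E : ObjectProperty.FullSubcategory P ⥤ ObjectProperty.FullSubcategory P' :=
    P'.lift (P.ι ⋙ e.inverse) (fun X => by
      have : PreservesFiniteProducts X.obj := X.property
      change PreservesFiniteProducts (_ ⋙ _)
      dsimp [e]
      infer_instance)
  have : (E ⋙ P'.ι).Full := inferInstanceAs (P.ι ⋙ e.inverse).Full
  have : (E ⋙ P'.ι).Faithful := inferInstanceAs (P.ι ⋙ e.inverse).Faithful
  have : E.Full := .of_comp_faithful E P'.ι
  have : E.Faithful := .of_comp E P'.ι
  have : E.EssSurj := ⟨fun Y => by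
    have : PreservesFiniteProducts Y.obj := Y.property
    refine ⟨⟨e.functor.obj Y.obj, ?_⟩, ⟨?_⟩⟩
    · change PreservesFiniteProducts (_ ⋙ _)
      infer_instance
    · exact P'.isoMk (e.unitIso.app Y.obj).symm⟩
  have : E.IsEquivalence := {}
  let i : E ⋙ P'.ι ⋙ e.functor ≅ P.ι := Functor.isoWhiskerLeft P.ι e.counitIso ≪≫ P.ι.rightUnitor
  exact Functor.isRightAdjoint_of_iso i

instance variety_hasColimits (T : Type u) [SmallCategory T] :
    HasColimitsOfSize.{u, u} (Variety T) :=
  have : Reflective (preservesProducts T (Type u)).ι :=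
    { L := _, adj := Adjunction.ofIsRightAdjoint _ }
  hasColimits_of_reflective (preservesProducts T (Type u)).ι

end Reflective

section Free

variable (T : Type u) [SmallCategory T] [LawvereTheory T]

instance underlying_isRightAdjoint : (underlying T (Type u)).IsRightAdjoint := inferInstance

/-- The free functor `Type u ⥤ Variety T`, left adjoint to the forgetful functor. -/
noncomputable def free : Type u ⥤ Variety T := (underlying T (Type u)).leftAdjoint

/-- The adjunction between the free and the forgetful functor. -/
noncomputable def freeAdj : free T ⊣ underlying T (Type u) :=
  Adjunction.ofIsRightAdjoint _

end Free

section Represented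

variable (T : Type u) [SmallCategory T]

/-- For a set `S` and a `T`-algebra `A`, the `T`-algebra `Hom(S, A) = A ^ S`, with underlying set
the maps from `S` to the underlying set of `A`. -/
def power (S : Type u) (A : Variety T) : Variety T where
  obj := A.obj ⋙ coyoneda.obj (op S)
  property := by
    have := A.property
    infer_instance

variable (D : Type w) [Category.{u} D]

/-- The functor `D ⥤ Variety T` represented by a co-`T`-algebra object `X` in `D`, sending `A` to
the `T`-algebra `Hom(X, A)`, as a covariant functor of `X : Model T Dᵒᵖ = (CoModel T D)ᵒᵖ`. -/
def cov : Model T Dᵒᵖ ⥤ (D ⥤ Variety T) where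
  obj X :=
    { obj A := 
        { obj := X.obj ⋙ yoneda.obj A
          property := by
            have := X.property
            infer_instance }
      map f := ObjectProperty.homMk (Functor.whiskerLeft X.obj (yoneda.map f)) }
  map g := { app A := ObjectProperty.homMk (Functor.whiskerRight g.hom (yoneda.obj A)) }

variable {T D} in
/-- The component at `A : D` and `t : T` of a morphism between represented functors. -/
def covComponent {X Y : Model T Dᵒᵖ} (α : (cov T D).obj X ⟶ (cov T D).obj Y) (A : D) (t : T)
    (g : (X.obj.obj t).unop ⟶ A) : (Y.obj.obj t).unop ⟶ A :=
  (α.app A).hom.app t g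

variable {T D} in
theorem covComponent_comp {X Y : Model T Dᵒᵖ} (α : (cov T D).obj X ⟶ (cov T D).obj Y)
    {A B : D} (t : T) (g : (X.obj.obj t).unop ⟶ A) (k : A ⟶ B) :
    covComponent α B t (g ≫ k) = covComponent α A t g ≫ k :=
  ConcreteCategory.congr_hom
    (NatTrans.congr_app (congr_arg InducedCategory.Hom.hom (α.naturality k)) t) g

variable {T D} in
theorem covComponent_map {X Y : Model T Dᵒᵖ} (α : (cov T D).obj X ⟶ (cov T D).obj Y)
    (A : D) {t t' : T} (f : t ⟶ t') (g : (X.obj.obj t).unop ⟶ A) :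
    covComponent α A t' ((X.obj.map f).unop ≫ g) = (Y.obj.map f).unop ≫ covComponent α A t g :=
  ConcreteCategory.congr_hom ((α.app A).hom.naturality f) g

/-- The Yoneda embedding of co-`T`-algebra objects into functors `D ⥤ Variety T` is fully
faithful. -/
def covFullyFaithful : (cov T D).FullyFaithful where
  preimage {X Y} α := ObjectProperty.homMk
    { app t := (covComponent α _ t (𝟙 _)).op
      naturality t t' f := by
        apply Quiver.Hom.unop_inj
        have h1 := covComponent_map α _ f (𝟙 _)
        have h2 := covComponent_comp α t' (𝟙 _) (X.obj.map f).unop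
        rw [Category.id_comp] at h2
        rw [Category.comp_id] at h1
        exact h2.symm.trans h1 }
  map_preimage {X Y} α := by
    ext A t g
    exact (covComponent_comp α t (𝟙 _) g).symm.trans
      (congr_arg (covComponent α A t) (Category.id_comp _))
  preimage_map {X Y} g := by
    ext t
    apply Quiver.Hom.unop_inj
    exact Category.comp_id _

instance cov_isRightAdjoint [HasColimitsOfSize.{u, u} D] (X : Model T Dᵒᵖ) :
    ((cov T D).obj X).IsRightAdjoint := by
  let A : Tᵒᵖ ⥤ D := X.obj.leftOp
  let R : D ⥤ (T ⥤ Type u) :=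
    Presheaf.restrictedULiftYoneda.{u} A ⋙ (opOpEquivalence T).congrLeft.functor
  have : (Presheaf.restrictedULiftYoneda.{u} A).IsRightAdjoint :=
    (Presheaf.uliftYonedaAdjunction.{u} (uliftYoneda.{u}.leftKanExtension A)
      (uliftYoneda.{u}.leftKanExtensionUnit A)).isRightAdjoint
  have : R.IsRightAdjoint := inferInstance
  let i : R ≅ (cov T D).obj X ⋙ (preservesProducts T (Type u)).ι :=
    NatIso.ofComponents (fun E => NatIso.ofComponents (fun t => Equiv.ulift.toIso))
  exact ((Adjunction.ofIsRightAdjoint R).restrictFullyFaithful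
    (preservesProducts T (Type u)).fullyFaithfulι (Functor.FullyFaithful.id D)
    (Functor.rightUnitor _).symm (Functor.leftUnitor _ ≪≫ i)).isRightAdjoint

end Represented


section Monoidal

attribute [local instance] endofunctorMonoidalCategory

variable (T : Type u) [SmallCategory T]

/-- The left adjoint of the endofunctor of `Variety T` represented by `X`. -/
noncomputable abbrev ladj (X : Model T (Variety T)ᵒᵖ) : Variety T ⥤ Variety T :=
  ((cov T (Variety T)).obj X).leftAdjoint

/-- The underlying object of the Tall-Wraith product `X ⊙ Y`: apply the left adjoint of the functor
represented by `Y` to the co-`T`-algebra object `X`. -/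
noncomputable def twObj (X Y : Model T (Variety T)ᵒᵖ) : Model T (Variety T)ᵒᵖ where
  obj := X.obj ⋙ (ladj T Y).op
  property := by
    have := X.property
    have := (Adjunction.ofIsRightAdjoint ((cov T (Variety T)).obj Y)).leftAdjoint_preservesColimits
    have : PreservesFiniteProducts (ladj T Y).op := preservesFiniteProducts_op _
    infer_instance

/-- The functor `A ↦ Hom(X, Hom(Y, A))` is represented by `X ⊙ Y`. -/
noncomputable def covTwObj (X Y : Model T (Variety T)ᵒᵖ) :
    (cov T (Variety T)).obj Y ⋙ (cov T (Variety T)).obj X ≅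
      (cov T (Variety T)).obj (twObj T X Y) :=
  NatIso.ofComponents (fun A => ObjectProperty.isoMk _ (NatIso.ofComponents (fun t =>
    ((Adjunction.ofIsRightAdjoint ((cov T (Variety T)).obj Y)).homEquiv
      (X.obj.obj t).unop A).symm.toIso) (fun {t t'} f => by
        ext g
        exact (Adjunction.ofIsRightAdjoint
          ((cov T (Variety T)).obj Y)).homEquiv_naturality_left_symm (X.obj.map f).unop g)))
    (fun {A B} k => by
      ext t g
      exact (Adjunction.ofIsRightAdjoint
          ((cov T (Variety T)).obj Y)).homEquiv_naturality_right_symm g k)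

/-- The contravariant functor sending `t` to the representable model `T(t, -)`. -/
def representableModel : T ⥤ (Variety T)ᵒᵖ where
  obj t := op { obj := coyoneda.obj (op t), property := by infer_instance }
  map f := (ObjectProperty.homMk (coyoneda.map f.op)).op

/-- The Yoneda lemma for `representableModel`. -/
def representableModelCompYoneda (A : Variety T) :
    A.obj ≅ representableModel T ⋙ yoneda.obj A :=
  NatIso.ofComponents (fun t => Equiv.toIso
    { toFun a := ObjectProperty.homMk (coyonedaEquiv.symm a)
      invFun g := coyonedaEquiv g.hom
      left_inv a := coyonedaEquiv.right_inv a
      right_inv g := by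
        apply ObjectProperty.hom_ext
        exact coyonedaEquiv.left_inv g.hom }) (fun {t t'} f => by
    refine ConcreteCategory.hom_ext _ _ fun a => ?_
    apply ObjectProperty.hom_ext
    exact coyonedaEquiv_symm_map f a)

/-- The co-`T`-algebra object in `Variety T` formed by the representable models `T(t, -)`. -/
def twUnit : Model T (Variety T)ᵒᵖ where
  obj := representableModel T
  property := by
    refine ⟨fun n => ⟨fun {K} => ⟨fun {c} hc => ⟨yonedaJointlyReflectsLimits _ _ fun A => ?_⟩⟩⟩⟩
    have := A.property
    have : PreservesFiniteProducts (representableModel T ⋙ yoneda.obj A) :=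
      
      ⟨fun n => preservesLimitsOfShape_of_natIso (representableModelCompYoneda T A)⟩
    exact isLimitOfPreserves (representableModel T ⋙ yoneda.obj A) hc

/-- The identity functor is represented by `twUnit`. -/
def covTwUnit : 𝟭 (Variety T) ≅ (cov T (Variety T)).obj (twUnit T) :=
  NatIso.ofComponents
    (fun A => ObjectProperty.isoMk _ (representableModelCompYoneda T A)) (fun {A B} k => by
      apply ObjectProperty.hom_ext
      ext t : 2
      refine ConcreteCategory.hom_ext _ _ fun a => ?_
      apply ObjectProperty.hom_ext
      apply coyonedaEquiv.injective
      exact (coyonedaEquiv.right_inv _).trans ((congr_arg _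
        (coyonedaEquiv.right_inv a).symm).trans (coyonedaEquiv_comp _ k.hom).symm))

/-- The functor sending a co-`T`-algebra object in `Variety T` to the endofunctor of `Variety T`
that it represents, where endofunctors carry the monoidal structure `F ⊗ G = F ∘ G`. (Mathlib's
tensor product of endofunctors is `F ⊗ G = F ⋙ G = G ∘ F`, hence the monoidal opposite.) -/
abbrev covEnd : Model T (Variety T)ᵒᵖ ⥤ (Variety T ⥤ Variety T)ᴹᵒᵖ :=
  cov T (Variety T) ⋙ mopFunctor (Variety T ⥤ Variety T)

/-- `covEnd` is fully faithful. -/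
def covEndFullyFaithful : (covEnd T).FullyFaithful where
  preimage f := (covFullyFaithful T (Variety T)).preimage f.unmop
  map_preimage f := congr_arg Quiver.Hom.mop
    ((covFullyFaithful T (Variety T)).map_preimage f.unmop)
  preimage_map f := (covFullyFaithful T (Variety T)).preimage_map f

instance : (covEnd T).Full := (covEndFullyFaithful T).full

instance : (covEnd T).Faithful := (covEndFullyFaithful T).faithful

/-- `X ⊙ Y` represents the composite of the functors represented by `X` and by `Y`. -/
noncomputable def covEndTensor (X Y : Model T (Variety T)ᵒᵖ) :
    (covEnd T).obj X ⊗ (covEnd T).obj Y ≅ (covEnd T).obj (twObj T X Y) :=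
  (covTwObj T X Y).mop

/-- `twUnit` represents the identity functor. -/
def covEndUnit : 𝟙_ (Variety T ⥤ Variety T)ᴹᵒᵖ ≅ (covEnd T).obj (twUnit T) :=
  (covTwUnit T).mop

/-- The data of the Tall-Wraith monoidal structure, with morphisms pulled back from the
composition of represented functors. -/
noncomputable instance twStruct : MonoidalCategoryStruct (Model T (Variety T)ᵒᵖ) where
  tensorObj X Y := twObj T X Y
  tensorUnit := twUnit T
  whiskerLeft X Y₁ Y₂ f := (covEndFullyFaithful T).preimage
    ((covEndTensor T X Y₁).inv ≫ ((covEnd T).obj X ◁ (covEnd T).map f) ≫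
      (covEndTensor T X Y₂).hom)
  whiskerRight {X₁ X₂} f Y := (covEndFullyFaithful T).preimage
    ((covEndTensor T X₁ Y).inv ≫ ((covEnd T).map f ▷ (covEnd T).obj Y) ≫
      (covEndTensor T X₂ Y).hom)
  tensorHom {X₁ Y₁ X₂ Y₂} f g := (covEndFullyFaithful T).preimage
    ((covEndTensor T X₁ X₂).inv ≫ ((covEnd T).map f ⊗ₘ (covEnd T).map g) ≫
      (covEndTensor T Y₁ Y₂).hom)
  associator X Y Z := (covEndFullyFaithful T).preimageIso
    (((covEndTensor T _ Z).symm ≪≫ ((covEndTensor T X Y).symm ⊗ᵢ .refl _)) ≪≫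
      α_ ((covEnd T).obj X) ((covEnd T).obj Y) ((covEnd T).obj Z) ≪≫
      ((.refl _ ⊗ᵢ covEndTensor T Y Z) ≪≫ covEndTensor T X _))
  leftUnitor X := (covEndFullyFaithful T).preimageIso
    (((covEndTensor T _ X).symm ≪≫ ((covEndUnit T).symm ⊗ᵢ .refl _)) ≪≫ λ_ ((covEnd T).obj X))
  rightUnitor X := (covEndFullyFaithful T).preimageIso
    (((covEndTensor T X _).symm ≪≫ (.refl _ ⊗ᵢ (covEndUnit T).symm)) ≪≫ ρ_ ((covEnd T).obj X))

/-- The compatibility of `twStruct` with composition of represented functors. -/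
noncomputable def twInducingData : Monoidal.InducingFunctorData (covEnd T) where
  μIso X Y := covEndTensor T X Y
  εIso := covEndUnit T
  whiskerLeft_eq _ _ _ _ := (covEndFullyFaithful T).map_preimage _
  whiskerRight_eq _ _ := (covEndFullyFaithful T).map_preimage _
  tensorHom_eq _ _ := (covEndFullyFaithful T).map_preimage _
  associator_eq _ _ _ := (covEndFullyFaithful T).map_preimage _
  leftUnitor_eq _ := (covEndFullyFaithful T).map_preimage _
  rightUnitor_eq _ := (covEndFullyFaithful T).map_preimage _

/-- The monoidal structure on `Model T (Variety T)ᵒᵖ` given by composition of represented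
functors. -/
noncomputable instance twModel : MonoidalCategory (Model T (Variety T)ᵒᵖ) :=
  Monoidal.induced (covEnd T) (twInducingData T)

/-- The Tall-Wraith monoidal structure on co-`T`-algebra objects in `Variety T`. -/
noncomputable instance tallWraith : MonoidalCategory (CoModel T (Variety T)) :=
  monoidalCategoryOp

/-- The functor from (the opposite of) co-`T`-algebra objects in `Variety T` to endofunctors is
strong monoidal. -/
noncomputable instance covEndMonoidal : (covEnd T).Monoidal :=
  Monoidal.fromInducedMonoidal (covEnd T) (twInducingData T)

end Monoidal

end TallWraith

/-!
The lift of the free functor is obtained from the functors `A ↦ A ^ S` that it is to represent.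

Taking the power `A ↦ A ^ S` is an endofunctor of the variety with a left adjoint (the `S`-fold
copower). Every right adjoint endofunctor `R` of the variety, with left adjoint `L`, is represented
by the co-algebra object `t ↦ L (T(t, -))` (`cov_essImage_of_isRightAdjoint`), since the models
`T(t, -)` represent the identity functor. As passing from co-algebra objects to represented
functors is fully faithful, the powers, which are contravariantly functorial in `S`, lift to a
functor `freeLift` from sets to co-algebra objects. At the distinguished object the isomorphism
`Hom(freeLift S, A) ≅ A ^ S` says that the underlying functor of `freeLift` is left adjoint to
the forgetful functor (`freeLiftAdj`), so it is the free functor by uniqueness of left adjoints,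
compatibly with the adjunction bijections.

The identifications `A ^ 1 = A` and `(A ^ R) ^ S = A ^ (S × R)` make the functor of powers strong
monoidal from sets to endofunctors under composition (`powerCoreMonoidal`). The Tall-Wraith
product is composition of represented functors, and a strong monoidal structure lifts along a
fully faithful strong monoidal functor (`coreMonoidalOfCompFullyFaithful`), so `freeLift` is
strong monoidal.
-/

namespace TallWraith

/-! ### Lifting and dualizing strong monoidal functors -/

section MonoidalFunctors

open Functor.LaxMonoidal Functor.OplaxMonoidal

variable {C D E : Type*} [Category* C] [Category* D] [Category* E]
  [MonoidalCategory C] [MonoidalCategory D] [MonoidalCategory E]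

/-- A strong monoidal structure on a functor lifts along a fully faithful strong monoidal
functor. -/
def coreMonoidalOfCompFullyFaithful (F : C ⥤ D) {G : D ⥤ E} (hG : G.FullyFaithful)
    [G.Monoidal] [(F ⋙ G).Monoidal] : F.CoreMonoidal where
  εIso := hG.preimageIso ((Functor.Monoidal.εIso G).symm ≪≫ Functor.Monoidal.εIso (F ⋙ G))
  μIso X Y := hG.preimageIso
    ((Functor.Monoidal.μIso G (F.obj X) (F.obj Y)).symm ≪≫ Functor.Monoidal.μIso (F ⋙ G) X Y)
  μIso_hom_natural_left f X' := hG.map_injective (by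
    simpa [← cancel_epi (μ G _ _), ← μ_natural_left_assoc] using! μ_natural_left (F ⋙ G) f X')
  μIso_hom_natural_right X' f := hG.map_injective (by
    simpa [← cancel_epi (μ G _ _), ← μ_natural_right_assoc] using! μ_natural_right (F ⋙ G) X' f)
  associativity X Y Z := hG.map_injective (by
    have h := Functor.LaxMonoidal.associativity (F ⋙ G) X Y Z
    dsimp only [Functor.comp_obj, Functor.comp_map] at h
    -- The excluded lemmas would undo the expansion of `G.map` on structure morphisms.
    simp [Functor.Monoidal.map_whiskerRight, Functor.Monoidal.map_whiskerLeft,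
      Functor.Monoidal.map_associator, h, -μ_natural_left, -μ_natural_right,
      -μ_natural_left_assoc, -μ_natural_right_assoc, -δ_natural_left_assoc,
      -δ_natural_right_assoc, -Functor.OplaxMonoidal.associativity_assoc])
  left_unitality X := hG.map_injective (by
    have h := Functor.LaxMonoidal.left_unitality (F ⋙ G) X
    dsimp only [Functor.comp_obj, Functor.comp_map] at h
    simp [Functor.Monoidal.map_whiskerRight, Functor.Monoidal.map_leftUnitor, h, -μ_natural_left,
      -μ_natural_left_assoc])
  right_unitality X := hG.map_injective (by
    have h := Functor.LaxMonoidal.right_unitality (F ⋙ G) X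
    dsimp only [Functor.comp_obj, Functor.comp_map] at h
    simp [Functor.Monoidal.map_whiskerLeft, Functor.Monoidal.map_rightUnitor, h, -μ_natural_right,
      -μ_natural_right_assoc])

/-- The functor `C ⥤ Dᵒᵖ` corresponding to a strong monoidal functor `Cᵒᵖ ⥤ D` is strong
monoidal. -/
def coreMonoidalRightOp (F : Cᵒᵖ ⥤ D) [F.Monoidal] : F.rightOp.CoreMonoidal where
  εIso := (Functor.Monoidal.εIso F).symm.op
  μIso X Y := (Functor.Monoidal.μIso F (op X) (op Y)).symm.op
  μIso_hom_natural_left f X' := Quiver.Hom.unop_inj (δ_natural_left F f.op (op X'))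
  μIso_hom_natural_right X' f := Quiver.Hom.unop_inj (δ_natural_right F (op X') f.op)
  associativity X Y Z := Quiver.Hom.unop_inj (by simp)
  left_unitality X := Quiver.Hom.unop_inj (by simp)
  right_unitality X := Quiver.Hom.unop_inj (by simp)

end MonoidalFunctors

/-! ### Powers of algebras -/

section Power

variable (T : Type u) [SmallCategory T]

/-- The functor `A ↦ A ^ S`, contravariantly functorial in `S`. -/
def powerFunctor : (Type u)ᵒᵖ ⥤ Variety T ⥤ Variety T where
  obj S :=
    { obj A := power T S.unop A
      map f := ObjectProperty.homMk (Functor.whiskerRight f.hom (coyoneda.obj S)) }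
  map g := { app A := ObjectProperty.homMk (Functor.whiskerLeft A.obj (coyoneda.map g)) }

/-- The forgetful functor to `T ⥤ Type u` followed by the pointwise `(-) ^ S` is a right adjoint,
and it factors through the full subcategory of algebras. -/
instance powerFunctor_isRightAdjoint (S : (Type u)ᵒᵖ) :
    ((powerFunctor T).obj S).IsRightAdjoint := by
  let R : Variety T ⥤ (T ⥤ Type u) :=
    (preservesProducts T (Type u)).ι ⋙ (Functor.whiskeringRight T _ _).obj (coyoneda.obj S)
  have : ((Functor.whiskeringRight T _ _).obj (coyoneda.obj S)).IsRightAdjoint :=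
    ((Types.tensorProductAdjunction S.unop).whiskerRight T).isRightAdjoint
  have : R.IsRightAdjoint := inferInstance
  exact ((Adjunction.ofIsRightAdjoint R).restrictFullyFaithful
    (preservesProducts T (Type u)).fullyFaithfulι (Functor.FullyFaithful.id _)
    (Functor.rightUnitor _).symm (Functor.leftUnitor _)).isRightAdjoint

/-- A right adjoint endofunctor `R` of `Variety T` is represented by the co-`T`-algebra
object `t ↦ L (T(t, -))`, where `L` is left adjoint to `R`: maps `L (T(t, -)) ⟶ A` are maps
`T(t, -) ⟶ R A`, that is, elements of `(R A)(t)`. -/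
theorem cov_essImage_of_isRightAdjoint (R : Variety T ⥤ Variety T) [R.IsRightAdjoint] :
    (cov T (Variety T)).essImage R := by
  have adj := Adjunction.ofIsRightAdjoint R
  let X : Model T (Variety T)ᵒᵖ :=
    { obj := (twUnit T).obj ⋙ R.leftAdjoint.op
      property := by
        have := (twUnit T).property
        have := adj.leftAdjoint_preservesColimits
        have : PreservesFiniteProducts R.leftAdjoint.op := preservesFiniteProducts_op _
        infer_instance }
  -- `X` represents `R` followed by the functor that `twUnit` represents, which is the identity.
  let i : R ⋙ (cov T (Variety T)).obj (twUnit T) ≅ (cov T (Variety T)).obj X :=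
    NatIso.ofComponents (fun A => ObjectProperty.isoMk _ (NatIso.ofComponents
      (fun t => (adj.homEquiv ((twUnit T).obj.obj t).unop A).symm.toIso)
      (fun {t t'} f => by
        ext g
        exact adj.homEquiv_naturality_left_symm ((twUnit T).obj.map f).unop g)))
      (fun {A B} k => by
        ext t g
        exact adj.homEquiv_naturality_right_symm g k)
  exact ⟨X, ⟨i.symm ≪≫ Functor.isoWhiskerLeft R (covTwUnit T).symm ≪≫ R.rightUnitor⟩⟩

attribute [local instance] endofunctorMonoidalCategory

/-- `A ^ 1 = A`. -/
def powerUnitIso : 𝟭 (Variety T) ≅ (powerFunctor T).obj (op PUnit) :=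
  NatIso.ofComponents (fun A => ObjectProperty.isoMk _ (NatIso.ofComponents (fun t =>
    Equiv.toIso
      { toFun a := ↾fun _ : PUnit => a
        invFun (g : PUnit.{u + 1} ⟶ A.obj.obj t) := g PUnit.unit
        left_inv a := rfl
        right_inv g := rfl })))

/-- `(A ^ R) ^ S = A ^ (S × R)`. -/
def powerProdIso (S R : Type u) :
    (powerFunctor T).obj (op R) ⋙ (powerFunctor T).obj (op S) ≅
      (powerFunctor T).obj (op (S × R)) :=
  NatIso.ofComponents (fun A => ObjectProperty.isoMk _ (NatIso.ofComponents (fun t =>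
    Equiv.toIso
      { toFun (g : S ⟶ (R ⟶ A.obj.obj t)) := ↾fun p : S × R => (g p.1) p.2
        invFun (g : S × R ⟶ A.obj.obj t) := ↾fun s : S => (↾fun r : R => g (s, r) : R ⟶ A.obj.obj t)
        left_inv a := rfl
        right_inv g := rfl })))

/-- The isomorphisms `A ^ 1 = A` and `(A ^ R) ^ S = A ^ (S × R)` make `S ↦ (A ↦ A ^ S)` strong
monoidal. The monoidal opposite appears because the functor for `S ⊗ R` applies `(-) ^ R` before
`(-) ^ S`, whereas the tensor product of endofunctors is in the order of composition `⋙`. -/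
def powerCoreMonoidal :
    (powerFunctor T ⋙ mopFunctor (Variety T ⥤ Variety T)).CoreMonoidal where
  εIso := (powerUnitIso T).mop
  μIso S R := (powerProdIso T S.unop R.unop).mop
  μIso_hom_natural_left _ _ := rfl
  μIso_hom_natural_right _ _ := rfl
  associativity _ _ _ := rfl
  left_unitality _ := rfl
  right_unitality _ := rfl

end Power

/-! ### The lift of the free functor -/

section Lift

attribute [local instance] endofunctorMonoidalCategory

variable (T : Type u) [SmallCategory T]

/-- The co-`T`-algebra object representing `A ↦ A ^ S`, contravariantly functorial in `S` because
it is regarded as an object of `Model T (Variety T)ᵒᵖ = (CoModel T (Variety T))ᵒᵖ`. -/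
noncomputable def powerRep : (Type u)ᵒᵖ ⥤ Model T (Variety T)ᵒᵖ :=
  haveI := (covFullyFaithful T (Variety T)).full
  haveI := (covFullyFaithful T (Variety T)).faithful
  Functor.essImage.liftFunctor (powerFunctor T) (cov T (Variety T))
    fun S => cov_essImage_of_isRightAdjoint T ((powerFunctor T).obj S)

/-- `powerRep` represents `powerFunctor`. -/
noncomputable def powerRepCov : powerRep T ⋙ cov T (Variety T) ≅ powerFunctor T :=
  haveI := (covFullyFaithful T (Variety T)).full
  haveI := (covFullyFaithful T (Variety T)).faithful
  Functor.essImage.liftFunctorCompIso (powerFunctor T) (cov T (Variety T))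
    fun S => cov_essImage_of_isRightAdjoint T ((powerFunctor T).obj S)

/-- The lift of the free functor to co-`T`-algebra objects. -/
noncomputable def freeLift : Type u ⥤ CoModel T (Variety T) := (powerRep T).rightOp

/-- The functor `covEnd` is fully faithful and strong monoidal, and its composite with `powerRep`
is the strong monoidal functor of powers; hence `powerRep` is strong monoidal. -/
noncomputable instance powerRepMonoidal : (powerRep T).Monoidal :=
  letI := (powerCoreMonoidal T).toMonoidal
  letI : (powerRep T ⋙ covEnd T).Monoidal := Functor.Monoidal.transport
    (Functor.isoWhiskerRight (powerRepCov T) (mopFunctor (Variety T ⥤ Variety T))).symm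
  (coreMonoidalOfCompFullyFaithful (powerRep T) (covEndFullyFaithful T)).toMonoidal

noncomputable instance freeLiftMonoidal : (freeLift T).Monoidal :=
  (coreMonoidalRightOp (powerRep T)).toMonoidal

variable [LawvereTheory T]

/-- The isomorphism `Hom(freeLift S, A) ≅ A ^ S` at the distinguished object. -/
noncomputable def freeLiftHomEquiv (S : Type u) (A : Variety T) :
    ((freeLift T ⋙ coUnderlying T (Variety T)).obj S ⟶ A) ≃
      (S ⟶ (underlying T (Type u)).obj A) :=
  ((underlying T (Type u)).mapIso (((powerRepCov T).app (op S)).app A)).toEquiv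

theorem freeLiftHomEquiv_naturality_left {S' S : Type u} {A : Variety T} (f : S' ⟶ S)
    (h : (freeLift T ⋙ coUnderlying T (Variety T)).obj S ⟶ A) :
    freeLiftHomEquiv T S' A ((freeLift T ⋙ coUnderlying T (Variety T)).map f ≫ h) =
      f ≫ freeLiftHomEquiv T S A h :=
  ConcreteCategory.congr_hom ((underlying T (Type u)).congr_map
    (NatTrans.congr_app ((powerRepCov T).hom.naturality f.op) A)) h

theorem freeLiftHomEquiv_naturality_right {S : Type u} {A A' : Variety T}
    (h : (freeLift T ⋙ coUnderlying T (Variety T)).obj S ⟶ A) (k : A ⟶ A') :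
    freeLiftHomEquiv T S A' (h ≫ k) =
      freeLiftHomEquiv T S A h ≫ (underlying T (Type u)).map k :=
  ConcreteCategory.congr_hom ((underlying T (Type u)).congr_map
    (((powerRepCov T).app (op S)).hom.naturality k)) h

/-- The underlying functor of `freeLift` is left adjoint to the forgetful functor. -/
noncomputable def freeLiftAdj :
    freeLift T ⋙ coUnderlying T (Variety T) ⊣ underlying T (Type u) :=
  Adjunction.mkOfHomEquiv
    { homEquiv := freeLiftHomEquiv T
      homEquiv_naturality_left_symm f g := by
        rw [Equiv.symm_apply_eq, freeLiftHomEquiv_naturality_left, Equiv.apply_symm_apply]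
      homEquiv_naturality_right := freeLiftHomEquiv_naturality_right T }

end Lift

end TallWraith

theorem mainTheorem1 (T : Type u) [SmallCategory T] [TallWraith.LawvereTheory T] :
    ∃ (Fhat : Type u ⥤ TallWraith.CoModel T (TallWraith.Variety T))
      (e : Fhat ⋙ TallWraith.coUnderlying T (TallWraith.Variety T) ≅ TallWraith.free T),
      -- `Hom(Fhat S, A) ≅ Hom(S, A)` as algebras, via the free-forgetful adjunction
      (∀ (S : Type u) (A : TallWraith.Variety T),
        ∃ φ : ((TallWraith.cov T (TallWraith.Variety T)).obj (Fhat.obj S).unop).obj A ≅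
            TallWraith.power T S A,
          ∀ h : (TallWraith.coUnderlying T (TallWraith.Variety T)).obj (Fhat.obj S) ⟶ A,
            (TallWraith.underlying T (Type u)).map φ.hom h =
              (TallWraith.freeAdj T).homEquiv S A (e.inv.app S ≫ h)) ∧
      -- `Fhat` is strong monoidal, from `(Type u, ×)` to co-algebras with the Tall-Wraith product
      Nonempty Fhat.Monoidal ∧
      (∀ S R : Type u, Nonempty (Fhat.obj (S × R) ≅ Fhat.obj S ⊗ Fhat.obj R)) ∧
      Nonempty (Fhat.obj PUnit.{u + 1} ≅ 𝟙_ (TallWraith.CoModel T (TallWraith.Variety T))) := by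
  refine ⟨TallWraith.freeLift T,
    (TallWraith.freeLiftAdj T).leftAdjointUniq (TallWraith.freeAdj T), fun S A =>
      ⟨((TallWraith.powerRepCov T).app (op S)).app A, fun h => ?_⟩, ⟨inferInstance⟩,
      fun S R => ⟨(Functor.Monoidal.μIso (TallWraith.freeLift T) S R).symm⟩,
      ⟨(Functor.Monoidal.εIso (TallWraith.freeLift T)).symm⟩⟩
  -- The comparison of the two left adjoints is compatible with their adjunction bijections.
  have h1 : (TallWraith.freeAdj T).homEquiv S A
      (((TallWraith.freeLiftAdj T).leftAdjointUniq (TallWraith.freeAdj T)).inv.app S ≫ h) =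
      (TallWraith.freeLiftAdj T).homEquiv S A h := by
    rw [Adjunction.homEquiv_naturality_right, Adjunction.leftAdjointUniq_inv_app,
      Adjunction.homEquiv_leftAdjointUniq_hom_app, ← Adjunction.homEquiv_unit]
  refine Eq.trans ?_ h1.symm
  rw [TallWraith.freeLiftAdj, Adjunction.mkOfHomEquiv_homEquiv]
  rfl
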